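/- Fix any universal recursive function $\Phi:\mathbb N\times\mathbb N\rightharpoonup\mathbb N$, i.e. a partial recursive function such that $\varphi_n:=\Phi(n,\cdot)$, $n\in\mathbb N=\{0,1,2,\dots\}$, runs through all partial recursive functions of one variable. Let $A_T:=\{n\in\mathbb N:\varphi_n\text{ is total}\}$, let $O_T:=\mathbb 1_{A_T}$ be the totality oracle, and for $A\subseteq\mathbb N$ let $x[A]:=\sum_{j\in A}2^{-(j+1)}$. For $\sigma\ge 0$ let $\mathcal E_\sigma$ be the set of entire functions $f$ such that for every $\varepsilon>0$ there is a constant $C(\varepsilon)$ with $|f(z)|\le C(\varepsilon)e^{(\sigma+\varepsilon)|z|}$ for all $z\in\mathbb C$, and let $\mathrm{bw}(f):=\min\{\sigma\ge0: f\in\mathcal E_\sigma\}$. Let $\mathcal{CE}_\pi$ be the set of all $f\in\mathcal E_\pi$ for which $(f^{(n)}(0))_{n\in\mathbb N}$ is a computable sequence of computable (complex) numbers, i.e. the real and the imaginary parts have computable double sequences of rational approximations with recursive moduli of convergence. For $x\in(0,4]$ let $A[x]\subseteq\mathbb N$ be the unique infinite set with $x=4\sum_{m\in A[x]}2^{-m}$,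 and let $A_n[x]:=\{m\in A[x]:m\le n+2\}$ (this records the first $n+2$ binary digits of $x$, those of weight $2,1,\tfrac12,\dots,2^{-n}$). Let $O_a$ be the oracle $(f,n)\mapsto x\big[A_n[\mathrm{bw}(f)]\big]\in\mathbb Q$. **Theorem.** There exist a signal $f\in\mathcal{CE}_\pi$, with $\mathrm{bw}(f)=2\,x[A_T]=\sum_{n\in A_T}2^{-n}$, and a Turing machine $TM$ which computes a mapping $\mathbb Q\times\mathbb N\to\{0,1\}$, $(x,n)\mapsto TM(x,n)$, such that $$TM(O_a(f,n),n)=O_T(n)\qquad\text{for all } n\in\mathbb N .$$ -/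

import Mathlib

namespace Bandlimited

/-! ### Bandlimited signals -/

/-- The entire functions that are bandlimited with bandwidth `σ`
(entire functions of exponential type at most `σ`). -/
def ESpace (σ : ℝ) : Set (ℂ → ℂ) :=
  {f | Differentiable ℂ f ∧
    ∀ ε : ℝ, 0 < ε → ∃ C : ℝ, ∀ z : ℂ, ‖f z‖ ≤ C * Real.exp ((σ + ε) * ‖z‖)}

/-- The actual bandwidth `min {σ ≥ 0 : f ∈ ESpace σ}`; the minimum is attained
as soon as `f` is bandlimited for some `σ ≥ 0`. -/
noncomputable def bw (f : ℂ → ℂ) : ℝ :=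
  sInf {σ : ℝ | 0 ≤ σ ∧ f ∈ ESpace σ}

/-! ### Computable numbers -/

/-- Notation of the rational numbers by natural numbers: if `m` codes the triple `(s, p, q)`,
then `m` denotes `(-1) ^ s * p / (1 + q)`. -/
def ratNotation (m : ℕ) : ℚ :=
  (-1) ^ m.unpair.1 * ((m.unpair.2.unpair.1 : ℚ) / (1 + (m.unpair.2.unpair.2 : ℚ)))

/-- A computable double sequence of rational numbers. -/
def IsComputableRatSeq₂ (r : ℕ → ℕ → ℚ) : Prop :=
  ∃ g : ℕ → ℕ → ℕ, Computable₂ g ∧ ∀ n s, r n s = ratNotation (g n s)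

/-- A computable sequence of computable real numbers: it has a computable double sequence of
rational approximations with a recursive modulus of convergence `ξ`. -/
def IsComputableRealSeq (x : ℕ → ℝ) : Prop :=
  ∃ r : ℕ → ℕ → ℚ, IsComputableRatSeq₂ r ∧ ∃ ξ : ℕ → ℕ → ℕ, Computable₂ ξ ∧
    ∀ n M s : ℕ, ξ n M ≤ s → |x n - (r n s : ℝ)| < 1 / 2 ^ M

/-- A computable sequence of computable complex numbers: real and imaginary parts form
computable sequences of computable real numbers. -/
def IsComputableComplexSeq (a : ℕ → ℂ) : Prop :=
  IsComputableRealSeq (fun n => (a n).re) ∧ IsComputableRealSeq (fun n => (a n).im)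

/-- The computable signals that are bandlimited with bandwidth `π`: the numbers
`a n = f⁽ⁿ⁾(0)` form a computable sequence of computable numbers. -/
def CEpi : Set (ℂ → ℂ) :=
  {f | f ∈ ESpace Real.pi ∧ IsComputableComplexSeq (fun n => iteratedDeriv n f 0)}

/-! ### Enumerations of the recursive functions and the totality oracle -/

/-- `Φ` is a universal recursive function: it is recursive in two variables, and the family
`φ n = Φ n` runs through all partial recursive functions of one variable. -/
def IsUniversal (Φ : ℕ → ℕ →. ℕ) : Prop :=
  Partrec₂ Φ ∧ ∀ g : ℕ →. ℕ, Nat.Partrec g → ∃ n, Φ n = g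

/-- The totality set: all indices `n` such that `φ n` is defined on all of `ℕ`. -/
def totalitySet (Φ : ℕ → ℕ →. ℕ) : Set ℕ :=
  {n | ∀ m, (Φ n m).Dom}

open Classical in
/-- The totality oracle: the indicator function of the totality set. -/
noncomputable def totalityOracle (Φ : ℕ → ℕ →. ℕ) (n : ℕ) : ℕ :=
  if n ∈ totalitySet Φ then 1 else 0

/-! ### Binary expansions and the bandwidth oracle -/

/-- The real number `x[A] = ∑_{j ∈ A} 1 / 2 ^ (j + 1)`. -/
noncomputable def binReal (A : Set ℕ) : ℝ :=
  ∑' j : A, 1 / (2 : ℝ) ^ ((j : ℕ) + 1)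

/-- `A` is the set of positions of the ones of the non-terminating binary expansion
`x = 4 * ∑_{m ∈ A} 1 / 2 ^ m`. -/
def IsDigitSet (x : ℝ) (A : Set ℕ) : Prop :=
  A.Infinite ∧ x = 4 * ∑' m : A, 1 / (2 : ℝ) ^ (m : ℕ)

open Classical in
/-- The infinite set `A[x]` with `x = 4 * ∑_{m ∈ A[x]} 1 / 2 ^ m`; it exists and is unique for
`0 < x ≤ 4`. (The value is `∅` if there is no such set.) -/
noncomputable def digitSet (x : ℝ) : Set ℕ :=
  if h : ∃ A, IsDigitSet x A then h.choose else ∅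

open Classical in
/-- The bandwidth oracle: `(f, n) ↦ x[A_n[bw f]]`, where `A_n[x] = {m ∈ A[x] : m ≤ n + 2}`.
The set `A_n[x]` is finite, so the answer is a rational number. -/
noncomputable def bandwidthOracle (f : ℂ → ℂ) (n : ℕ) : ℚ :=
  ∑ m ∈ (Finset.range (n + 3)).filter (fun m => m ∈ digitSet (bw f)), 1 / (2 : ℚ) ^ (m + 1)

/-! ### Computability of mappings between sets with notations -/

/-- There is a Turing machine that computes `G : α → β` with respect to the notations `να` of `α`
and `νβ` of `β`: some recursive function maps each number that denotes `a` to a number that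
denotes `G a`. -/
def IsTuringComputable {α β : Type} (να : ℕ → α) (νβ : ℕ → β) (G : α → β) : Prop :=
  ∃ g : ℕ → ℕ, Computable g ∧ ∀ c : ℕ, νβ (g c) = G (να c)

/-- Notation of the pairs `(x, n)` with `x` rational and `n` natural. -/
def ratNatNotation (c : ℕ) : ℚ × ℕ :=
  (ratNotation c.unpair.1, c.unpair.2)

end Bandlimited

/-! The exponential type of an entire `f` is the limsup of `|f⁽ⁱ⁾(0)|^(1/i)`. Prescribing `f⁽ⁱ⁾(0) =
qᵢ ^ i` with bounded `qᵢ ≥ 0` therefore gives bandwidth `limsup qᵢ` (`bw_taylorFun_pow`), and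
rational `qᵢ` keep the derivatives exactly computable.

Totality is a `Π₂` property, so twice its binary real is such a limsup. A finite guess `D` proposes
its own dyadic value whenever a longer list of convergence checks first succeeds for its members. A
wrong member below a given bound survives only finitely many proposals (`eventually_stageValue_le`),
while true finite approximations propose again and again (`frequently_le_stageValue`).

The totality set is infinite, so its indicator is the non-terminating expansion of the bandwidth,
shifted by two places. The last digit in the oracle's answer thus decides totality
(`digitExtractor_bandwidthOracle`). -/

namespace Bandlimited
open Filter Topology

/-! ### Entire functions with prescribed Taylor coefficients -/

/-- The power series with `n`-th derivative `a n` at the origin. -/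
noncomputable def taylorSeries (a : ℕ → ℂ) : FormalMultilinearSeries ℂ ℂ ℂ :=
  FormalMultilinearSeries.ofScalars ℂ fun n => a n / n.factorial

/-- The function with `n`-th derivative `a n` at the origin. -/
noncomputable def taylorFun (a : ℕ → ℂ) : ℂ → ℂ := (taylorSeries a).sum

theorem taylorFun_eq_tsum (a : ℕ → ℂ) (z : ℂ) :
    taylorFun a z = ∑' n, a n / n.factorial * z ^ n := by
  exact (FormalMultilinearSeries.ofScalars_sum_eq (E := ℂ) _ z).trans (by simp)

theorem taylorSeries_radius {a : ℕ → ℂ} {K B : ℝ} (ha : ∀ n, ‖a n‖ ≤ K * B ^ n) :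
    (taylorSeries a).radius = ⊤ := by
  refine FormalMultilinearSeries.radius_eq_top_of_summable_norm _ fun r => ?_
  refine Summable.of_nonneg_of_le (fun n => by positivity) (fun n => ?_)
    ((Real.summable_pow_div_factorial (B * r)).mul_left K)
  have h : ‖taylorSeries a n‖ = ‖a n‖ / n.factorial := by
    simp [taylorSeries]
  rw [h, mul_pow]
  calc ‖a n‖ / n.factorial * (r : ℝ) ^ n ≤ (K * B ^ n) / n.factorial * (r : ℝ) ^ n := by
        gcongr; exact ha n
    _ = K * (B ^ n * r ^ n / n.factorial) := by ring

theorem hasFPowerSeriesOnBall_taylorFun {a : ℕ → ℂ} {K B : ℝ} (ha : ∀ n, ‖a n‖ ≤ K * B ^ n) :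
    HasFPowerSeriesOnBall (taylorFun a) (taylorSeries a) 0 ⊤ := by
  have h := taylorSeries_radius ha
  rw [← h]
  exact FormalMultilinearSeries.hasFPowerSeriesOnBall _ (by simp [h])

theorem differentiable_taylorFun {a : ℕ → ℂ} {K B : ℝ} (ha : ∀ n, ‖a n‖ ≤ K * B ^ n) : Differentiable ℂ (taylorFun a) := fun z =>
  ((hasFPowerSeriesOnBall_taylorFun ha).analyticOnNhd z (by simp)).differentiableAt

theorem iteratedDeriv_taylorFun {a : ℕ → ℂ} {K B : ℝ} (ha : ∀ n, ‖a n‖ ≤ K * B ^ n) (n : ℕ) : iteratedDeriv n (taylorFun a) 0 = a n := by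
  have h := (hasFPowerSeriesOnBall_taylorFun ha).factorial_smul (1 : ℂ) n
  rw [iteratedDeriv_eq_iteratedFDeriv, ← h]
  have : (n.factorial : ℂ) ≠ 0 := by exact_mod_cast n.factorial_ne_zero
  simp [taylorSeries, FormalMultilinearSeries.ofScalars, nsmul_eq_mul]
  field_simp

theorem norm_taylorFun_le {a : ℕ → ℂ} {K B : ℝ} (ha : ∀ n, ‖a n‖ ≤ K * B ^ n) (z : ℂ) :
    ‖taylorFun a z‖ ≤ K * Real.exp (B * ‖z‖) := by
  rw [taylorFun_eq_tsum]
  have hs : HasSum (fun n : ℕ => K * ((B * ‖z‖) ^ n / n.factorial))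
      (K * Real.exp (B * ‖z‖)) := by
    rw [Real.exp_eq_exp_ℝ]
    exact (NormedSpace.expSeries_div_hasSum_exp (B * ‖z‖)).mul_left K
  refine tsum_of_norm_bounded hs fun n => ?_
  rw [norm_mul, norm_div, norm_pow, Complex.norm_natCast, mul_pow]
  calc ‖a n‖ / n.factorial * ‖z‖ ^ n ≤ (K * B ^ n) / n.factorial * ‖z‖ ^ n := by
        gcongr; exact ha n
    _ = K * (B ^ n * ‖z‖ ^ n / n.factorial) := by ring

theorem taylorFun_mem_ESpace {a : ℕ → ℂ} {σ : ℝ}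
    (ha : ∀ ε : ℝ, 0 < ε → ∃ K, ∀ n, ‖a n‖ ≤ K * (σ + ε) ^ n) : taylorFun a ∈ ESpace σ := by
  refine ⟨?_, fun ε hε => ?_⟩
  · obtain ⟨K, hK⟩ := ha 1 one_pos
    exact differentiable_taylorFun hK
  · obtain ⟨K, hK⟩ := ha ε hε
    exact ⟨K, norm_taylorFun_le hK⟩

/-! ### Exponential type and the growth of derivatives at the origin -/

/-- Stirling's sequence decreases from its value `e / √2` at `1`; the resulting factor `√n` is
weakened to `n`, which is harmless after taking `n`-th roots. -/
theorem factorial_le_mul_div_exp_pow {n : ℕ} (hn : n ≠ 0) :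
    (n.factorial : ℝ) ≤ Real.exp 1 * n * (n / Real.exp 1) ^ n := by
  obtain ⟨m, rfl⟩ := Nat.exists_eq_succ_of_ne_zero hn
  have h := Stirling.stirlingSeq'_antitone (Nat.zero_le m)
  simp only [Function.comp_apply, Nat.succ_eq_add_one, zero_add, Stirling.stirlingSeq_one] at h
  rw [Stirling.stirlingSeq, div_le_iff₀ (by positivity)] at h
  refine h.trans (le_of_eq_of_le (by ring) (b := Real.exp 1 * (√(2 * ((m + 1 : ℕ) : ℝ)) / √2) *
    (((m + 1 : ℕ) : ℝ) / Real.exp 1) ^ (m + 1)) ?_)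
  gcongr
  rw [Real.sqrt_mul (by norm_num), mul_div_cancel_left₀ _ (by positivity)]
  rw [Real.sqrt_le_left (by positivity)]
  have : (1 : ℝ) ≤ ((m + 1 : ℕ) : ℝ) := by exact_mod_cast Nat.succ_pos m
  nlinarith

/-- Cauchy's estimate for functions of exponential type. -/
theorem norm_iteratedDeriv_le_of_exponential_type {f : ℂ → ℂ} (hf : Differentiable ℂ f)
    {C s : ℝ} (hs : 0 < s) (hC : ∀ z, ‖f z‖ ≤ C * Real.exp (s * ‖z‖)) {n : ℕ} (hn : n ≠ 0) :
    ‖iteratedDeriv n f 0‖ ≤ C * Real.exp 1 * n * s ^ n := by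
  have hn0 : (0 : ℝ) < n := by positivity
  have hC0 : 0 ≤ C := by simpa using (norm_nonneg _).trans (hC 0)
  -- The radius `n / s` minimises `exp (s * R) / R ^ n`.
  have h := Complex.norm_iteratedDeriv_le_of_forall_mem_sphere_norm_le (c := 0) (R := n / s)
    (C := C * Real.exp n) n (by positivity) hf.diffContOnCl (fun z hz => by
      have hz' : ‖z‖ = n / s := by simpa using hz
      have := hC z
      rwa [hz', mul_div_cancel₀ _ hs.ne'] at this)
  refine h.trans ?_
  calc (n.factorial : ℝ) * (C * Real.exp n) / (n / s) ^ n
      ≤ Real.exp 1 * n * (n / Real.exp 1) ^ n * (C * Real.exp n) / (n / s) ^ n := by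
        gcongr; exact factorial_le_mul_div_exp_pow hn
    _ = C * Real.exp 1 * n * s ^ n := by
        have : Real.exp n = Real.exp 1 ^ n := by rw [← Real.exp_nat_mul, mul_one]
        rw [this, div_pow, div_pow]
        field_simp

theorem le_of_frequently_pow_le {v s K : ℝ} (hs : 0 < s)
    (h : ∃ᶠ n : ℕ in atTop, v ^ n ≤ K * n * s ^ n) : v ≤ s := by
  by_contra! hlt
  have h1 : Tendsto (fun n : ℕ => K * ((n : ℝ) ^ 1 * (s / v) ^ n)) atTop (𝓝 (K * 0)) :=
    (tendsto_pow_const_mul_const_pow_of_abs_lt_one 1 (by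
      rw [abs_of_pos (div_pos hs (hs.trans hlt)), div_lt_one (hs.trans hlt)]
      exact hlt)).const_mul K
  rw [mul_zero] at h1
  refine h (((tendsto_order.1 h1).2 1 one_pos).mono fun n hn => ?_)
  rw [not_le]
  have hv : 0 < v ^ n := pow_pos (hs.trans hlt) n
  rw [pow_one, div_pow, ← mul_assoc, ← mul_div_assoc, div_lt_one hv] at hn
  exact hn

section PowerCoefficients

variable {q : ℕ → ℝ} {B σ : ℝ}

theorem exists_pow_le_mul_pow (hq0 : ∀ n, 0 ≤ q n) (hqB : ∀ n, q n ≤ B) (hσ : 0 ≤ σ)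
    (hupper : ∀ ε : ℝ, 0 < ε → ∀ᶠ n in atTop, q n ≤ σ + ε) {ε : ℝ} (hε : 0 < ε) :
    ∃ K, ∀ n, ‖((q n ^ n : ℝ) : ℂ)‖ ≤ K * (σ + ε) ^ n := by
  obtain ⟨N, hN⟩ := eventually_atTop.1 (hupper ε hε)
  have hs : 0 < σ + ε := by positivity
  have hB : 0 ≤ B := (hq0 0).trans (hqB 0)
  -- The `1` serves `n ≥ N`; the sum absorbs the finitely many earlier indices.
  refine ⟨1 + ∑ i ∈ Finset.range N, (B / (σ + ε)) ^ i, fun n => ?_⟩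
  have hsum : 0 ≤ ∑ i ∈ Finset.range N, (B / (σ + ε)) ^ i :=
    Finset.sum_nonneg fun i _ => by positivity
  rw [Complex.norm_real, Real.norm_of_nonneg (pow_nonneg (hq0 n) n)]
  rcases le_or_gt N n with h | h
  · calc q n ^ n ≤ 1 * (σ + ε) ^ n := by
          rw [one_mul]; exact pow_le_pow_left₀ (hq0 n) (hN n h) n
      _ ≤ _ := by gcongr; linarith
  · have h1 : (B / (σ + ε)) ^ n ≤ ∑ i ∈ Finset.range N, (B / (σ + ε)) ^ i :=
      Finset.single_le_sum (f := fun i => (B / (σ + ε)) ^ i) (fun i _ => by positivity)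
        (Finset.mem_range.2 h)
    calc q n ^ n ≤ B ^ n := pow_le_pow_left₀ (hq0 n) (hqB n) n
      _ = (B / (σ + ε)) ^ n * (σ + ε) ^ n := by rw [← mul_pow, div_mul_cancel₀ _ hs.ne']
      _ ≤ _ := by gcongr; linarith

/-- The last two hypotheses say `limsup q = σ`. Coefficient bounds give type at most `σ`; Cauchy's
estimate at the infinitely many large `q n` excludes a smaller type. -/
theorem bw_taylorFun_pow (hq0 : ∀ n, 0 ≤ q n) (hqB : ∀ n, q n ≤ B) (hσ : 0 ≤ σ)
    (hupper : ∀ ε : ℝ, 0 < ε → ∀ᶠ n in atTop, q n ≤ σ + ε)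
    (hlower : ∀ ε : ℝ, 0 < ε → ∃ᶠ n in atTop, σ - ε ≤ q n) :
    bw (taylorFun fun n => ((q n ^ n : ℝ) : ℂ)) = σ := by
  have hK := fun ε hε => exists_pow_le_mul_pow hq0 hqB hσ hupper (ε := ε) hε
  refine le_antisymm (csInf_le ⟨0, fun τ hτ => hτ.1⟩ ⟨hσ, taylorFun_mem_ESpace hK⟩)
    (le_csInf ⟨σ, hσ, taylorFun_mem_ESpace hK⟩ ?_)
  rintro τ ⟨hτ, hf, hC⟩
  refine le_of_forall_pos_le_add fun ε hε => ?_
  -- Only for `ε < σ` is the base `σ - ε / 2` known to be positive, as monotonicity of powers needs.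
  rcases le_or_gt σ ε with hle | hlt
  · linarith
  obtain ⟨C, hC⟩ := hC (ε / 2) (by positivity)
  have hs : 0 < τ + ε / 2 := by positivity
  obtain ⟨K, hK1⟩ := hK 1 one_pos
  suffices σ - ε / 2 ≤ τ + ε / 2 by linarith
  refine le_of_frequently_pow_le (K := C * Real.exp 1) hs ?_
  refine ((hlower (ε / 2) (by positivity)).and_eventually (eventually_ne_atTop 0)).mono ?_
  rintro n ⟨h1, h2⟩
  refine (pow_le_pow_left₀ (by linarith) h1 n).trans ?_
  have := norm_iteratedDeriv_le_of_exponential_type hf hs hC h2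
  rwa [iteratedDeriv_taylorFun hK1, Complex.norm_real,
    Real.norm_of_nonneg (pow_nonneg (hq0 n) n)] at this

end PowerCoefficients

theorem ESpace_mono {σ τ : ℝ} (h : σ ≤ τ) : ESpace σ ⊆ ESpace τ := by
  rintro f ⟨hf, hC⟩
  refine ⟨hf, fun ε hε => ?_⟩
  obtain ⟨C, hC⟩ := hC ε hε
  have hC0 : 0 ≤ C := by simpa using (norm_nonneg _).trans (hC 0)
  exact ⟨C, fun z => (hC z).trans (by gcongr)⟩

end Bandlimited
namespace Bandlimited

/-! ### Binary expansions -/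

open Classical in
/-- The natural number whose binary digits are the first `N` digits of `A`, the digit
of `0` being the most significant one. -/
noncomputable def prefixValue (A : Set ℕ) : ℕ → ℕ
  | 0 => 0
  | N + 1 => 2 * prefixValue A N + if N ∈ A then 1 else 0

theorem prefixValue_succ_mod_two (A : Set ℕ) (N : ℕ) :
    prefixValue A (N + 1) % 2 = 1 ↔ N ∈ A := by
  rw [prefixValue]
  split_ifs with h <;> simp [h]

open Classical in
theorem sum_range_eq_prefixValue_div (K : Type*) [Field K] [CharZero K] (A : Set ℕ) (N : ℕ) :
    ∑ m ∈ Finset.range N, (if m ∈ A then 1 / (2 : K) ^ (m + 1) else 0) =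
      prefixValue A N / 2 ^ N := by
  induction N with
  | zero => simp [prefixValue]
  | succ N ih =>
    rw [Finset.sum_range_succ, ih, prefixValue]
    split_ifs <;> push_cast <;> field_simp <;> ring

theorem prefixValue_mono {A B : Set ℕ} {N : ℕ} (h : ∀ m < N, m ∈ A → m ∈ B) :
    prefixValue A N ≤ prefixValue B N := by
  induction N with
  | zero => simp [prefixValue]
  | succ N ih =>
    have h1 := ih fun m hm => h m (hm.trans N.lt_succ_self)
    have h2 := h N N.lt_succ_self
    simp only [prefixValue]
    split_ifs with h3 h4
    · omega
    · exact absurd (h2 h3) h4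
    · omega
    · omega

open Classical in
theorem hasSum_binReal (A : Set ℕ) :
    HasSum (fun m => if m ∈ A then 1 / (2 : ℝ) ^ (m + 1) else 0) (binReal A) := by
  have hs : Summable fun m : ℕ => 1 / (2 : ℝ) ^ (m + 1) := by
    simpa [pow_succ, div_eq_mul_inv, mul_comm] using summable_geometric_two.mul_left (1 / 2 : ℝ)
  have h := (hs.indicator A).hasSum
  rw [← tsum_subtype A] at h
  exact h.congr_fun fun m => by simp [Set.indicator_apply]

theorem binReal_eq_prefixValue_add (A : Set ℕ) (N : ℕ) :
    binReal A = prefixValue A N / 2 ^ N + binReal {m | m + N ∈ A} / 2 ^ N := by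
  classical
  rw [← (hasSum_binReal A).tsum_eq, ← (hasSum_binReal A).summable.sum_add_tsum_nat_add N,
    sum_range_eq_prefixValue_div, ← (hasSum_binReal {m | m + N ∈ A}).tsum_eq, ← tsum_div_const]
  congr 2
  ext m
  simp only [Set.mem_ofPred_eq]
  split_ifs
  · rw [div_div, ← pow_add]; congr 2; ring
  · simp

theorem binReal_nonneg (A : Set ℕ) : 0 ≤ binReal A :=
  tsum_nonneg fun _ => by positivity

theorem binReal_le_one (A : Set ℕ) : binReal A ≤ 1 := by
  classical
  have h : HasSum (fun m : ℕ => 1 / (2 : ℝ) ^ (m + 1)) 1 := by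
    simpa [pow_succ, div_eq_mul_inv, mul_comm] using hasSum_geometric_two.mul_left (1 / 2 : ℝ)
  refine hasSum_le (fun m => ?_) (hasSum_binReal A) h
  split_ifs
  · exact le_rfl
  · positivity

theorem binReal_pos {A : Set ℕ} (hA : A.Nonempty) : 0 < binReal A := by
  classical
  obtain ⟨m, hm⟩ := hA
  have h := le_hasSum (hasSum_binReal A) m fun i _ => by split_ifs <;> positivity
  simp only [hm, if_true] at h
  exact lt_of_lt_of_le (by positivity) h

theorem prefixValue_div_le_binReal (A : Set ℕ) (N : ℕ) :
    (prefixValue A N : ℝ) / 2 ^ N ≤ binReal A := by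
  rw [binReal_eq_prefixValue_add A N]
  have := binReal_nonneg {m | m + N ∈ A}
  simp only [le_add_iff_nonneg_right]
  positivity

theorem binReal_le_prefixValue_div_add (A : Set ℕ) (N : ℕ) :
    binReal A ≤ (prefixValue A N : ℝ) / 2 ^ N + 1 / 2 ^ N := by
  rw [binReal_eq_prefixValue_add A N]
  have := binReal_le_one {m | m + N ∈ A}
  gcongr

theorem prefixValue_div_lt_binReal {A : Set ℕ} (hA : A.Infinite) (N : ℕ) :
    (prefixValue A N : ℝ) / 2 ^ N < binReal A := by
  rw [binReal_eq_prefixValue_add A N]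
  have : 0 < binReal {m | m + N ∈ A} := by
    obtain ⟨m, hm, hN⟩ := hA.exists_gt N
    exact binReal_pos ⟨m - N, by simpa [Nat.sub_add_cancel hN.le] using hm⟩
  simp only [lt_add_iff_pos_right]
  positivity

theorem prefixValue_div_le_prefixValue_div (A : Set ℕ) {M N : ℕ} (h : M ≤ N) :
    (prefixValue A M : ℝ) / 2 ^ M ≤ prefixValue A N / 2 ^ N := by
  classical
  rw [← sum_range_eq_prefixValue_div, ← sum_range_eq_prefixValue_div]
  exact Finset.sum_le_sum_of_subset_of_nonneg (Finset.range_mono h)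
    fun i _ _ => by split_ifs <;> positivity

/-- Non-terminating binary expansions are unique. -/
theorem eq_of_binReal_eq {A B : Set ℕ} (hA : A.Infinite) (hB : B.Infinite)
    (h : binReal A = binReal B) : A = B := by
  -- Infinitude makes the lower bound strict: two integers satisfy `a < 2 ^ N * x ≤ b + 1`, hence `a
  -- ≤ b`.
  have key : ∀ {A B : Set ℕ}, A.Infinite → binReal A = binReal B → ∀ N,
      prefixValue A N ≤ prefixValue B N := by
    intro A B hA h N
    have h1 := prefixValue_div_lt_binReal hA N
    have h2 := binReal_le_prefixValue_div_add B N
    rw [h] at h1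
    have h3 := h1.trans_le h2
    rw [← add_div, div_lt_div_iff_of_pos_right (by positivity)] at h3
    exact Nat.lt_succ_iff.1 (by exact_mod_cast h3)
  ext N
  rw [← prefixValue_succ_mod_two, ← prefixValue_succ_mod_two,
    le_antisymm (key hA h (N + 1)) (key hB h.symm (N + 1))]

theorem four_mul_tsum_eq (A : Set ℕ) :
    4 * ∑' m : A, 1 / (2 : ℝ) ^ (m : ℕ) = 8 * binReal A := by
  rw [binReal, ← tsum_mul_left, ← tsum_mul_left]
  congr 1
  ext m
  rw [pow_succ]
  field_simp
  norm_num

theorem digitSet_eq {x : ℝ} {A : Set ℕ} (hA : IsDigitSet x A) : digitSet x = A := by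
  have hex : ∃ A, IsDigitSet x A := ⟨A, hA⟩
  rw [digitSet, dif_pos hex]
  obtain ⟨h1, h2⟩ := hex.choose_spec
  obtain ⟨h3, h4⟩ := hA
  rw [four_mul_tsum_eq] at h2 h4
  exact eq_of_binReal_eq h1 h3 (by linarith)

/-- The positions `0` and `1`, of weight `4` and `2`, stay empty, so position `n + 2` carries the
weight `2 ^ (-n)`. -/
theorem isDigitSet_two_mul_binReal {A : Set ℕ} (hA : A.Infinite) :
    IsDigitSet (2 * binReal A) ((· + 2) '' A) := by
  refine ⟨hA.image (add_left_injective 2).injOn, ?_⟩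
  have h := binReal_eq_prefixValue_add ((· + 2) '' A) 2
  have h1 : {m | m + 2 ∈ (· + 2) '' A} = A := by ext m; simp
  have h2 : prefixValue ((· + 2) '' A) 2 = 0 := by simp [prefixValue]
  rw [h1, h2] at h
  rw [four_mul_tsum_eq, h]
  norm_num
  ring

theorem bandwidthOracle_eq (f : ℂ → ℂ) (n : ℕ) :
    bandwidthOracle f n = prefixValue (digitSet (bw f)) (n + 3) / 2 ^ (n + 3) := by
  classical
  rw [← sum_range_eq_prefixValue_div, bandwidthOracle, Finset.sum_filter]

/-! ### Extracting digits from rational numbers -/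

/-- The binary digit of weight `2 ^ (-(n + 3))` of `|x|`, for the pair `(x, n)`. -/
def digitExtractor (p : ℚ × ℕ) : ℕ := ⌊|p.1| * 2 ^ (p.2 + 3)⌋₊ % 2

theorem digitExtractor_eq_zero_or_one (p : ℚ × ℕ) :
    digitExtractor p = 0 ∨ digitExtractor p = 1 :=
  Nat.mod_two_eq_zero_or_one _

theorem primrec₂_pow : Primrec₂ fun a b : ℕ => a ^ b := by
  have h : Primrec₂ fun a b : ℕ => Nat.rec (motive := fun _ => ℕ) 1 (fun _ y => y * a) b :=
    Primrec.nat_rec (Primrec.const 1)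
      (Primrec.nat_mul.comp (Primrec.snd.comp Primrec.snd) Primrec.fst).to₂
  refine h.of_eq fun a b => ?_
  induction b with
  | zero => rfl
  | succ b ih => rw [pow_succ, ← ih]

theorem abs_ratNotation (m : ℕ) :
    |ratNotation m| = (m.unpair.2.unpair.1 : ℚ) / ((1 + m.unpair.2.unpair.2 : ℕ) : ℚ) := by
  rw [ratNotation, abs_mul, abs_pow, abs_neg, abs_one, one_pow, one_mul, abs_of_nonneg]
  · push_cast; rfl
  · positivity

/-- On codes the floor is natural-number division, so unreduced fractions cause no ambiguity; the
absolute value discards the sign code. -/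
theorem isTuringComputable_digitExtractor :
    IsTuringComputable ratNatNotation id digitExtractor := by
  refine ⟨fun c => c.unpair.1.unpair.2.unpair.1 * 2 ^ (c.unpair.2 + 3) /
    (1 + c.unpair.1.unpair.2.unpair.2) % 2, ?_, fun c => ?_⟩
  · have h1 : Primrec fun c : ℕ => c.unpair.1 := Primrec.fst.comp Primrec.unpair
    have h2 : Primrec fun c : ℕ => c.unpair.2 := Primrec.snd.comp Primrec.unpair
    have h3 := h2.comp h1
    exact (Primrec.nat_mod.comp (Primrec.nat_div.comp
      (Primrec.nat_mul.comp (h1.comp h3)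
        (primrec₂_pow.comp (Primrec.const 2) (Primrec.nat_add.comp h2 (Primrec.const 3))))
      (Primrec.nat_add.comp (Primrec.const 1) (h2.comp h3))) (Primrec.const 2)).to_comp
  · simp only [id, digitExtractor, ratNatNotation, abs_ratNotation]
    rw [div_mul_eq_mul_div, ← Nat.floor_div_eq_div (K := ℚ)]
    push_cast
    rfl

theorem digitExtractor_bandwidthOracle {f : ℂ → ℂ} {A : Set ℕ} (hA : A.Infinite)
    (hf : bw f = 2 * binReal A) (n : ℕ) :
    digitExtractor (bandwidthOracle f n, n) = 1 ↔ n ∈ A := by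
  have h : |bandwidthOracle f n| * 2 ^ (n + 3) = (prefixValue ((· + 2) '' A) (n + 3) : ℚ) := by
    rw [bandwidthOracle_eq, hf, digitSet_eq (isDigitSet_two_mul_binReal hA),
      abs_of_nonneg (by positivity), div_mul_cancel₀ _ (by positivity)]
  rw [digitExtractor]
  simp only [h, Nat.floor_natCast]
  rw [prefixValue_succ_mod_two]
  simp

end Bandlimited
namespace Bandlimited
open Filter Topology

/-! ### Approximating the binary real of a `Π₂` set from above in the limit -/

/-- The set whose indicator function is given by the binary digits of `D`. -/
def bitSet (D : ℕ) : Set ℕ := {n | D.testBit n = true}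

theorem exists_bitSet_eq (A : Set ℕ) (N : ℕ) : ∃ D, bitSet D = {n | n < N ∧ n ∈ A} := by
  classical
  refine ⟨Nat.ofBits fun i : Fin N => decide (i.1 ∈ A), ?_⟩
  ext n
  simp [bitSet, Nat.testBit_ofBits]

section Stages

variable (P : ℕ → ℕ → ℕ → Prop)

/-- By time `s`, the first `k` instances of `P n` have been verified for all the `n < k` that
are coded by `D`. -/
def VerifiedBy (D k s : ℕ) : Prop := ∀ j < k, ∀ n < k, n ∈ bitSet D → P n j s

/-- The index `i` codes `((D, k), s)`, where `k` instances have been verified for `D` by time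
`s + 1`, but not before. -/
def IsStage (i : ℕ) : Prop :=
  i.unpair.1.unpair.1 ≤ i.unpair.1.unpair.2 ∧
    VerifiedBy P i.unpair.1.unpair.1 i.unpair.1.unpair.2 (i.unpair.2 + 1) ∧
    ¬ VerifiedBy P i.unpair.1.unpair.1 i.unpair.1.unpair.2 i.unpair.2

open Classical in
/-- The numerator of `stageValue P i`. -/
noncomputable def stageNumerator (i : ℕ) : ℕ :=
  if IsStage P i then prefixValue (bitSet i.unpair.1.unpair.1) i.unpair.1.unpair.2 else 0

/-- The dyadic rational number proposed at stage `i`. -/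
noncomputable def stageValue (i : ℕ) : ℝ :=
  2 * ((stageNumerator P i : ℝ) / 2 ^ i.unpair.1.unpair.2)

theorem stageValue_nonneg (i : ℕ) : 0 ≤ stageValue P i := by
  unfold stageValue
  positivity

theorem stageValue_le_two (i : ℕ) : stageValue P i ≤ 2 := by
  unfold stageValue stageNumerator
  split_ifs
  · have h1 := prefixValue_div_le_binReal (bitSet i.unpair.1.unpair.1) i.unpair.1.unpair.2
    have h2 := binReal_le_one (bitSet i.unpair.1.unpair.1)
    linarith
  · simp

variable {P} {A : Set ℕ} (hmono : ∀ n m s t, s ≤ t → P n m s → P n m t)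
  (hA : ∀ n, n ∈ A ↔ ∀ m, ∃ s, P n m s)

include hmono in
theorem VerifiedBy.mono {D k s t : ℕ} (hst : s ≤ t) (h : VerifiedBy P D k s) :
    VerifiedBy P D k t := fun j hj n hn hD => hmono n j s t hst (h j hj n hn hD)

include hmono in
-- The bound `D ≤ k` leaves finitely many pairs `(D, k)`, and by monotonicity each pair is first
-- verified at no more than one time.
theorem finite_isStage_lt (M : ℕ) : {i | IsStage P i ∧ i.unpair.1.unpair.2 < M}.Finite := by
  refine Set.Finite.of_finite_image (f := fun i => i.unpair.1.unpair)
    (((Set.finite_lt_nat M).prod (Set.finite_lt_nat M)).subset ?_) ?_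
  · rintro _ ⟨i, ⟨hi, hM⟩, rfl⟩
    exact ⟨hi.1.trans_lt hM, hM⟩
  · rintro i ⟨hi, -⟩ j ⟨hj, -⟩ hij
    have hij : i.unpair.1.unpair = j.unpair.1.unpair := hij
    have key : ∀ {i j : ℕ}, IsStage P i → IsStage P j → i.unpair.1.unpair = j.unpair.1.unpair →
        i.unpair.2 ≤ j.unpair.2 := by
      intro i j hi hj hij
      by_contra! hlt
      have := hj.2.1
      rw [← hij] at this
      exact hi.2.2 (this.mono hmono hlt)
    have h1 : i.unpair.1 = j.unpair.1 := by
      rw [← Nat.pair_unpair i.unpair.1, hij, Nat.pair_unpair]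
    rw [← Nat.pair_unpair i, ← Nat.pair_unpair j, h1,
      le_antisymm (key hi hj hij) (key hj hi hij.symm)]

include hA in
-- Each `n < N` outside `A` has an instance that is never verified; `M` exceeds all of these
-- instances.
theorem exists_forall_verifiedBy_mem (N : ℕ) :
    ∃ M, ∀ D k s, M ≤ k → VerifiedBy P D k s → ∀ n < N, n ∈ bitSet D → n ∈ A := by
  classical
  have h : ∀ n, ∃ m, n ∉ A → ∀ s, ¬ P n m s := fun n => by
    by_cases hn : n ∈ A
    · exact ⟨0, fun h => absurd hn h⟩
    · have := hn
      rw [hA] at this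
      push Not at this
      obtain ⟨m, hm⟩ := this
      exact ⟨m, fun _ => hm⟩
  choose m hm using h
  refine ⟨N + (Finset.range N).sup fun n => m n + 1, fun D k s hk hv n hn hD => ?_⟩
  by_contra hnA
  have h1 : m n + 1 ≤ (Finset.range N).sup fun n => m n + 1 :=
    Finset.le_sup (f := fun n => m n + 1) (Finset.mem_range.2 hn)
  exact hm n hnA s (hv (m n) (by omega) n (by omega) hD)

include hmono hA in
theorem eventually_stageValue_le {ε : ℝ} (hε : 0 < ε) :
    ∀ᶠ i in atTop, stageValue P i ≤ 2 * binReal A + ε := by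
  obtain ⟨N, hN⟩ := exists_pow_lt_of_lt_one (show 0 < ε / 2 by positivity)
    (show (1 / 2 : ℝ) < 1 by norm_num)
  obtain ⟨M, hM⟩ := exists_forall_verifiedBy_mem hA N
  -- All but finitely many indices are either no stage, with value `0`, or have `k ≥ M`, so that the
  -- guess has no wrong member below `N`.
  have hfin := (finite_isStage_lt hmono M).isCompact.compl_mem_cocompact
  rw [cocompact_eq_cofinite, Nat.cofinite_eq_atTop] at hfin
  filter_upwards [hfin] with i hi
  rw [stageValue, stageNumerator]
  split_ifs with hs
  · have hk : M ≤ i.unpair.1.unpair.2 := by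
      by_contra! h
      exact hi ⟨hs, h⟩
    have h1 := hM _ _ _ hk hs.2.1
    have h2 := prefixValue_div_le_binReal (bitSet i.unpair.1.unpair.1) i.unpair.1.unpair.2
    have h3 := binReal_le_prefixValue_div_add (bitSet i.unpair.1.unpair.1) N
    have h4 : (prefixValue (bitSet i.unpair.1.unpair.1) N : ℝ) / 2 ^ N ≤
        prefixValue A N / 2 ^ N := by
      gcongr
      exact prefixValue_mono h1
    have h5 := prefixValue_div_le_binReal A N
    rw [one_div_pow] at hN
    linarith
  · have := binReal_nonneg A
    simp only [Nat.cast_zero, zero_div, mul_zero]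
    positivity

include hmono hA in
theorem exists_verifiedBy {D k : ℕ} (hD : bitSet D ⊆ A) : ∃ s, VerifiedBy P D k s := by
  classical
  have h : ∀ n j, ∃ s, n ∈ A → P n j s := fun n j => by
    by_cases hn : n ∈ A
    · obtain ⟨s, hs⟩ := (hA n).1 hn j
      exact ⟨s, fun _ => hs⟩
    · exact ⟨0, fun h => absurd h hn⟩
  choose s hs using h
  refine ⟨(Finset.range k ×ˢ Finset.range k).sup fun p => s p.1 p.2, fun j hj n hn hnD => ?_⟩
  refine hmono n j (s n j) _ ?_ (hs n j (hD hnD))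
  exact Finset.le_sup (f := fun p : ℕ × ℕ => s p.1 p.2) (b := (n, j)) (by simp [hj, hn])

include hmono hA in
theorem frequently_le_stageValue (hzero : ∀ n m, ¬ P n m 0) (hne : A.Nonempty) {ε : ℝ}
    (hε : 0 < ε) : ∃ᶠ i in atTop, 2 * binReal A - ε ≤ stageValue P i := by
  classical
  obtain ⟨n₀, hn₀⟩ := hne
  obtain ⟨N, hN⟩ := exists_pow_lt_of_lt_one (show 0 < ε / 2 by positivity)
    (show (1 / 2 : ℝ) < 1 by norm_num)
  -- The cut-off also puts `n₀` into `D`, which prevents vacuous verification at time `0`.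
  obtain ⟨D, hD⟩ := exists_bitSet_eq A (N + n₀ + 1)
  have hDA : bitSet D ⊆ A := by
    rw [hD]; exact fun n hn => hn.2
  refine frequently_atTop.2 fun a => ?_
  -- The summand `a` pushes the index past `a`, as pairing dominates its arguments; the others
  -- secure `D ≤ k`, `N ≤ k` and `n₀ < k`.
  set k := a + D + N + n₀ + 1 with hk
  have hex := exists_verifiedBy hmono hA (k := k) hDA
  have hspec := Nat.find_spec hex
  have hpos : Nat.find hex ≠ 0 := fun h0 => by
    rw [h0] at hspec
    exact hzero n₀ 0 (hspec 0 (by omega) n₀ (by omega) (by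
      rw [hD]; exact ⟨by omega, hn₀⟩))
  obtain ⟨s, hs⟩ := Nat.exists_eq_succ_of_ne_zero hpos
  have hnot : ¬ VerifiedBy P D k s := Nat.find_min hex (by omega)
  rw [hs] at hspec
  refine ⟨Nat.pair (Nat.pair D k) s, ?_, ?_⟩
  · have h1 := Nat.right_le_pair D k
    have h2 := Nat.left_le_pair (Nat.pair D k) s
    omega
  · have hstage : IsStage P (Nat.pair (Nat.pair D k) s) := by
      simp only [IsStage, Nat.unpair_pair]
      exact ⟨by omega, hspec, hnot⟩
    rw [stageValue, stageNumerator, if_pos hstage]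
    simp only [Nat.unpair_pair]
    have h1 := prefixValue_div_le_prefixValue_div (bitSet D) (show N ≤ k by omega)
    have h2 : (prefixValue A N : ℝ) / 2 ^ N ≤ prefixValue (bitSet D) N / 2 ^ N := by
      gcongr
      refine prefixValue_mono fun m hm hmA => ?_
      rw [hD]
      exact ⟨by omega, hmA⟩
    have h3 := binReal_le_prefixValue_div_add A N
    rw [one_div_pow] at hN
    linarith

end Stages

/-! ### Computability of the stages -/

theorem primrecRel_mem_bitSet : PrimrecRel fun D n : ℕ => n ∈ bitSet D := by
  have h : PrimrecRel fun D n : ℕ => D / 2 ^ n % 2 = 1 :=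
    Primrec.eq.comp₂ (Primrec.nat_mod.comp (Primrec.nat_div.comp Primrec.fst
      (primrec₂_pow.comp (Primrec.const 2) Primrec.snd)) (Primrec.const 2)).to₂
      (Primrec.const 1).to₂
  refine h.of_eq fun D n => ?_
  simp [bitSet, Nat.testBit_eq_decide_div_mod_eq]

theorem primrec₂_prefixValue_bitSet : Primrec₂ fun D k => prefixValue (bitSet D) k := by
  classical
  have hite : Primrec₂ fun (D : ℕ) (p : ℕ × ℕ) =>
      2 * p.2 + if p.1 ∈ bitSet D then 1 else 0 :=
    (Primrec.nat_add.comp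
      (Primrec.nat_mul.comp (Primrec.const 2) (Primrec.snd.comp Primrec.snd))
      (Primrec.ite (primrecRel_mem_bitSet.comp Primrec.fst (Primrec.fst.comp Primrec.snd))
        (Primrec.const 1) (Primrec.const 0))).to₂
  refine (Primrec.nat_rec (Primrec.const 0) hite).of_eq fun D k => ?_
  induction k with
  | zero => rfl
  | succ k ih => simp only [prefixValue, ← ih]

theorem primrecRel_forall_lt {β : Type*} [Primcodable β] {R : ℕ → β → Prop} (hR : PrimrecRel R) :
    PrimrecRel fun n b => ∀ x < n, R x b :=
  (hR.forall_mem_list.comp (Primrec.list_range.comp Primrec.fst) Primrec.snd).of_eq (by simp)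

/-- Verification involves only quantifiers bounded by `k`. -/
theorem primrecPred_isStage {P : ℕ → ℕ → ℕ → Prop}
    (hP : PrimrecPred fun p : ℕ × ℕ × ℕ => P p.1 p.2.1 p.2.2) : PrimrecPred (IsStage P) := by
  have h1 : PrimrecRel fun (n : ℕ) (p : ℕ × ℕ × ℕ) => n ∈ bitSet p.2.1 → P n p.1 p.2.2 := by
    have hm : PrimrecRel fun (n : ℕ) (p : ℕ × ℕ × ℕ) => n ∈ bitSet p.2.1 :=
      primrecRel_mem_bitSet.comp (Primrec.fst.comp (Primrec.snd.comp Primrec.snd)) Primrec.fst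
    have hp : PrimrecRel fun (n : ℕ) (p : ℕ × ℕ × ℕ) => P n p.1 p.2.2 :=
      hP.comp (Primrec.pair Primrec.fst (Primrec.pair (Primrec.fst.comp Primrec.snd)
        (Primrec.snd.comp (Primrec.snd.comp Primrec.snd))))
    exact (PrimrecPred.or hm.not hp).of_eq fun _ => imp_iff_not_or.symm
  have hall := primrecRel_forall_lt h1
  have h2 : PrimrecPred fun a : ℕ × ℕ × ℕ × ℕ =>
      ∀ n < a.2.2.1, n ∈ bitSet a.2.1 → P n a.1 a.2.2.2 :=
    hall.comp
      (Primrec.fst.comp (Primrec.snd.comp Primrec.snd))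
      (Primrec.pair Primrec.fst (Primrec.pair (Primrec.fst.comp Primrec.snd)
        (Primrec.snd.comp (Primrec.snd.comp Primrec.snd))))
  have h3 : PrimrecPred fun p : ℕ × ℕ × ℕ => VerifiedBy P p.1 p.2.1 p.2.2 :=
    (primrecRel_forall_lt (h2.primrecRel (α := ℕ) (β := ℕ × ℕ × ℕ))).comp (Primrec.fst.comp Primrec.snd) Primrec.id
  have hfst : Primrec fun c : ℕ => c.unpair.1 := Primrec.fst.comp Primrec.unpair
  have hsnd : Primrec fun c : ℕ => c.unpair.2 := Primrec.snd.comp Primrec.unpair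
  have hD := hfst.comp hfst
  have hk := hsnd.comp hfst
  exact (Primrec.nat_le.comp hD hk).and
    ((h3.comp (Primrec.pair hD (Primrec.pair hk (Primrec.succ.comp hsnd)))).and
      (h3.comp (Primrec.pair hD (Primrec.pair hk hsnd))).not)

theorem primrec_stageNumerator {P : ℕ → ℕ → ℕ → Prop}
    (hP : PrimrecPred fun p : ℕ × ℕ × ℕ => P p.1 p.2.1 p.2.2) : Primrec (stageNumerator P) := by
  classical
  have hfst : Primrec fun c : ℕ => c.unpair.1 := Primrec.fst.comp Primrec.unpair
  have hsnd : Primrec fun c : ℕ => c.unpair.2 := Primrec.snd.comp Primrec.unpair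
  exact Primrec.ite (primrecPred_isStage hP)
    (primrec₂_prefixValue_bitSet.comp (hfst.comp hfst) (hsnd.comp hfst)) (Primrec.const 0)

theorem IsComputableRealSeq.of_ratNotation {x : ℕ → ℝ} {g : ℕ → ℕ} (hg : Computable g)
    (hx : ∀ n, x n = (ratNotation (g n) : ℝ)) : IsComputableRealSeq x := by
  refine ⟨fun n _ => ratNotation (g n), ⟨fun n _ => g n, hg.comp Computable.fst, fun _ _ => rfl⟩,
    fun _ _ => 0, Computable.const 0, fun n M s _ => ?_⟩
  simp [hx]

theorem isComputableRealSeq_stageValue_pow {P : ℕ → ℕ → ℕ → Prop}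
    (hP : PrimrecPred fun p : ℕ × ℕ × ℕ => P p.1 p.2.1 p.2.2) :
    IsComputableRealSeq fun i => stageValue P i ^ i := by
  have hfst : Primrec fun c : ℕ => c.unpair.1 := Primrec.fst.comp Primrec.unpair
  have hsnd : Primrec fun c : ℕ => c.unpair.2 := Primrec.snd.comp Primrec.unpair
  -- The sign code is `0`, and `1` is subtracted because `ratNotation` adds `1` to the coded
  -- denominator.
  refine .of_ratNotation (g := fun i => Nat.pair 0 (Nat.pair ((2 * stageNumerator P i) ^ i)
    ((2 ^ i.unpair.1.unpair.2) ^ i - 1))) (Primrec.to_comp ?_) fun i => ?_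
  · exact Primrec₂.natPair.comp (Primrec.const 0) (Primrec₂.natPair.comp
      (primrec₂_pow.comp (Primrec.nat_mul.comp (Primrec.const 2) (primrec_stageNumerator hP))
        Primrec.id)
      (Primrec.nat_sub.comp (primrec₂_pow.comp
        (primrec₂_pow.comp (Primrec.const 2) (hsnd.comp hfst)) Primrec.id) (Primrec.const 1)))
  · simp only [ratNotation, Nat.unpair_pair, stageValue]
    rw [Nat.cast_sub (Nat.one_le_pow _ _ (by positivity))]
    push_cast
    rw [add_sub_cancel, ← mul_div_assoc, div_pow]
    simp

/-! ### The totality set -/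

/-- Distinct constant functions are total and have distinct indices. -/
theorem IsUniversal.infinite_totalitySet {Φ : ℕ → ℕ →. ℕ} (hΦ : IsUniversal Φ) :
    (totalitySet Φ).Infinite := by
  have h : ∀ k : ℕ, ∃ n, Φ n = ((fun _ => k : ℕ → ℕ) : ℕ →. ℕ) := fun k =>
    hΦ.2 _ (Nat.Partrec.of_primrec (Nat.Primrec.const k))
  choose e he using h
  refine Set.infinite_of_injective_forall_mem (f := e) (fun k l hkl => ?_) fun k m => ?_
  · have h1 := he k
    rw [hkl, he l] at h1
    have h2 := congrFun h1 0
    simpa using h2.symm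
  · rw [he k]
    trivial

/-- This is the `Π₂` form of totality: `P n m s` says that a fixed program for `Φ` halts on `(n, m)`
with resource bound `s`. With bound `0` nothing halts. -/
theorem exists_primrecPred_of_partrec₂ {Φ : ℕ → ℕ →. ℕ} (hΦ : Partrec₂ Φ) :
    ∃ P : ℕ → ℕ → ℕ → Prop, PrimrecPred (fun p : ℕ × ℕ × ℕ => P p.1 p.2.1 p.2.2) ∧
      (∀ n m s t, s ≤ t → P n m s → P n m t) ∧ (∀ n m, ¬ P n m 0) ∧
      ∀ n, n ∈ totalitySet Φ ↔ ∀ m, ∃ s, P n m s := by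
  obtain ⟨c, hc⟩ := Nat.Partrec.Code.exists_code.1 (Partrec₂.unpaired'.2 hΦ)
  refine ⟨fun n m s => (c.evaln s (Nat.pair n m)).isSome = true, ?_, ?_, ?_, ?_⟩
  · have h : Primrec fun p : ℕ × ℕ × ℕ => (c.evaln p.2.2 (Nat.pair p.1 p.2.1)).isSome :=
      Primrec.option_isSome.comp (Nat.Partrec.Code.primrec_evaln.comp
        (Primrec.pair (Primrec.pair (Primrec.snd.comp Primrec.snd) (Primrec.const c))
          (Primrec₂.natPair.comp Primrec.fst (Primrec.fst.comp Primrec.snd))))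
    exact Primrec.eq.comp h (Primrec.const true)
  · intro n m s t hst h
    obtain ⟨x, hx⟩ := Option.isSome_iff_exists.1 h
    exact Option.isSome_iff_exists.2 ⟨x, Nat.Partrec.Code.evaln_mono hst hx⟩
  · intro n m
    simp [Nat.Partrec.Code.evaln]
  · intro n
    refine forall_congr' fun m => ?_
    have h : Φ n m = c.eval (Nat.pair n m) := by rw [hc]; simp [Nat.unpaired]
    rw [h, Part.dom_iff_mem]
    simp only [Nat.Partrec.Code.evaln_complete, Option.isSome_iff_exists]
    exact exists_comm

end Bandlimited

/-! ### The signal and the machine -/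

theorem mainTheorem9 (Φ : ℕ → ℕ →. ℕ) (hΦ : Bandlimited.IsUniversal Φ) :
    ∃ f : ℂ → ℂ, f ∈ Bandlimited.CEpi ∧
      Bandlimited.bw f = 2 * Bandlimited.binReal (Bandlimited.totalitySet Φ) ∧
      ∃ TM : ℚ × ℕ → ℕ,
        Bandlimited.IsTuringComputable Bandlimited.ratNatNotation id TM ∧
        (∀ p, TM p = 0 ∨ TM p = 1) ∧
        ∀ n : ℕ, TM (Bandlimited.bandwidthOracle f n, n) = Bandlimited.totalityOracle Φ n := by
  open Bandlimited in
  obtain ⟨P, hP, hmono, hzero, hA⟩ := exists_primrecPred_of_partrec₂ hΦ.1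
  have hinf := hΦ.infinite_totalitySet
  have hσ : 0 ≤ 2 * binReal (totalitySet Φ) := mul_nonneg two_pos.le (binReal_nonneg _)
  have hpow := fun ε hε => exists_pow_le_mul_pow (stageValue_nonneg P) (stageValue_le_two P) hσ
    (fun ε hε => eventually_stageValue_le hmono hA hε) (ε := ε) hε
  have hbw := bw_taylorFun_pow (stageValue_nonneg P) (stageValue_le_two P) hσ
    (fun ε hε => eventually_stageValue_le hmono hA hε)
    (fun ε hε => frequently_le_stageValue hmono hA hzero hinf.nonempty hε)
  refine ⟨_, ⟨ESpace_mono ?_ (taylorFun_mem_ESpace hpow), ?_⟩, hbw, digitExtractor,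
    isTuringComputable_digitExtractor, digitExtractor_eq_zero_or_one, fun n => ?_⟩
  -- The bandwidth is at most `2`, hence below `π`.
  · linarith [binReal_le_one (totalitySet Φ), Real.pi_gt_three]
  · obtain ⟨K, hK⟩ := hpow 1 one_pos
    simp only [IsComputableComplexSeq, iteratedDeriv_taylorFun hK, Complex.ofReal_re,
      Complex.ofReal_im]
    exact ⟨isComputableRealSeq_stageValue_pow hP,
      .of_ratNotation (Computable.const 0) fun n => by simp [ratNotation]⟩
  · have h := digitExtractor_bandwidthOracle hinf hbw n
    rw [totalityOracle]
    split_ifs with hn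
    · exact h.2 hn
    · exact (digitExtractor_eq_zero_or_one _).resolve_right fun h1 => hn (h.1 h1)
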